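/- Theorem (Hessian bound for WeightNorm). For every $\beta$ there is a constant $C>0$, depending only on $\beta$, such that the following holds. Let $\phi:\mathbb R\to\mathbb R$ be twice differentiable with $|\phi'|\le 1$ and $|\phi''|\le\beta$ everywhere. Let $L,m\ge 1$ and $d$ be integers, put $m_0=d$ and $m_l=m$ for $1\le l\le L$, and for hidden weight matrices $W^{(l)}\in\mathbb R^{m_l\times m_{l-1}}$ with rows $W^{(l)}_i\neq 0$ and an output vector $v\in\mathbb R^m$ let $\theta\in\mathbb R^{dm+(L-1)m^2+m}$ be the vector of all parameters and $$\alpha^{(0)}(x)=x,\qquad \alpha^{(l)}_i(x)=\phi\Big(\tfrac1{\sqrt m}\,\tfrac{(W^{(l)}_i)^\top\alpha^{(l-1)}(x)}{\|W^{(l)}_i\|_2}\Big)\ (1\le i\le m,\ 1\le l\le L),\qquad f(\theta;x)=v^\top\alpha^{(L)}(x).$$ Let $\|\bar W\|_2=\min_{1\le l\le L,\,1\le i\le m}\|W^{(l)}_i\|_2$. Then for every unit vector $v_0\in\mathbb R^m$, every $\rho_1$, every $x\in\mathbb R^d$ with $\|x\|_2=1$, and every $\theta$ as above (all rows $W_i^{(l)}$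 nonzero) with $\|v-v_0\|_2\le\rho_1$, the function $f(\cdot;x)$ is twice differentiable at $\theta$ and the spectral norm of its Hessian with respect to all parameters satisfies $$\big\|\nabla^2_\theta f(\theta;x)\big\|_2\le C\,\frac{(1+\rho_1)L^3\Big(\frac1{\sqrt m}+L^2\max\{|\phi(0)|,|\phi(0)|^2\}\Big)}{\min\{\|\bar W\|_2,\|\bar W\|_2^2\}}.$$ -/

import Mathlib

noncomputable section

namespace WeightNorm

/-- Index set of the parameters of a network with `L` hidden layers, where layer `l` has `n l` units
(`n 0` is the input dimension): the entries `W^{(l+1)}_{i j}` of the hidden weight matrices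
`W^{(l+1)} ∈ ℝ^{n (l+1) × n l}`, `0 ≤ l < L`, and the entries of the output vector `v ∈ ℝ^{n L}`. -/
abbrev ParamIdx (n : ℕ → ℕ) (L : ℕ) : Type :=
  (Σ l : Fin L, Fin (n ((l : ℕ) + 1)) × Fin (n (l : ℕ))) ⊕ Fin (n L)

/-- The space `ℝ^p` of all parameters, with its Euclidean norm. -/
abbrev Param (n : ℕ → ℕ) (L : ℕ) : Type := EuclideanSpace ℝ (ParamIdx n L)

variable {n : ℕ → ℕ} {L : ℕ}

/-- The `i`-th row of the hidden weight matrix `W^{(l+1)}`, for `0 ≤ l < L`. -/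
def row (θ : Param n L) (l : Fin L) (i : Fin (n ((l : ℕ) + 1))) :
    EuclideanSpace ℝ (Fin (n (l : ℕ))) :=
  WithLp.toLp 2 fun j => θ (Sum.inl ⟨l, i, j⟩)

/-- The output-layer vector `v`. -/
def outVec (θ : Param n L) : EuclideanSpace ℝ (Fin (n L)) :=
  WithLp.toLp 2 fun i => θ (Sum.inr i)

/-- The activation vectors: `α^{(0)} = x` and
`α^{(l+1)}_i = φ ((1 / √(n (l+1))) * ⟨W^{(l+1)}_i, α^{(l)}⟩ / ‖W^{(l+1)}_i‖)`. -/
def act (φ : ℝ → ℝ) (θ : Param n L) (x : EuclideanSpace ℝ (Fin (n 0))) :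
    (l : ℕ) → l ≤ L → EuclideanSpace ℝ (Fin (n l))
  | 0, _ => x
  | l + 1, h => WithLp.toLp 2 fun i =>
      φ (1 / √(n (l + 1) : ℝ) *
        (inner ℝ (row θ ⟨l, h⟩ i) (act φ θ x l (Nat.le_of_succ_le h)) / ‖row θ ⟨l, h⟩ i‖))

/-- The WeightNorm network `f(θ; x) = vᵀ α^{(L)}(x)`. -/
def predictor (φ : ℝ → ℝ) (x : EuclideanSpace ℝ (Fin (n 0))) (θ : Param n L) : ℝ :=
  inner ℝ (outVec θ) (act φ θ x L le_rfl)

/-- The minimum weight vector norm: the least Euclidean norm of a row of a hidden weight matrix. -/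
def minRowNorm (θ : Param n L) : ℝ :=
  ⨅ p : Σ l : Fin L, Fin (n ((l : ℕ) + 1)), ‖row θ p.1 p.2‖

/-- The Hessian `∇²g(θ)` as a linear operator on `ℝ^p`: the derivative of the gradient. Its
operator norm for the Euclidean norm is the spectral norm of the Hessian matrix. -/
def hessian (g : Param n L → ℝ) (θ : Param n L) : Param n L →L[ℝ] Param n L :=
  fderiv ℝ (gradient g) θ

end WeightNorm

end

/-! The value, first and second derivatives of each activation vector in `θ` are controlled together
by `JetBound`, which obeys a chain rule (`JetBound.comp`) and a Leibniz rule (`JetBound.bilin`). If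
all rows have norm at least `w`, normalizing them is a map with derivatives at most `2 / w` and `6 /
w ^ 2`, and the normalized matrix has Frobenius norm at most `√m`. The factor `1 / √m` cancels this
norm exactly, and `|φ'| ≤ 1`, so a layer passes on the derivatives of its input with coefficient 1.
Hence errors add up over the layers instead of multiplying, and the bounds are polynomial in `L`
(`jetBound_layer`, `jetBound_act`). One more Leibniz rule for `vᵀ α^{(L)}` bounds the second
derivative, and the Riesz isometry turns this into a bound on the Hessian. -/

namespace WeightNorm

open Filter Topology

set_option maxSynthPendingDepth 3

/-! ### Calculus of second-order bounds -/

section Jets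

variable {E F G H : Type*} [NormedAddCommGroup E] [NormedSpace ℝ E]
  [NormedAddCommGroup F] [NormedSpace ℝ F] [NormedAddCommGroup G] [NormedSpace ℝ G]
  [NormedAddCommGroup H] [NormedSpace ℝ H]

/-- `g` is twice differentiable at `x`, and the norms of its value, derivative and second derivative
at `x` are at most `b₀`, `b₁` and `b₂`. -/
def JetBound (g : E → F) (x : E) (b₀ b₁ b₂ : ℝ) : Prop :=
  ∃ (g' : E → E →L[ℝ] F) (g'' : E →L[ℝ] E →L[ℝ] F),
    (∀ᶠ y in 𝓝 x, HasFDerivAt g (g' y) y) ∧ HasFDerivAt g' g'' x ∧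
      ‖g x‖ ≤ b₀ ∧ ‖g' x‖ ≤ b₁ ∧ ‖g''‖ ≤ b₂

/-- The value is bounded afresh, not through `b₀`, so a direct estimate may replace the cruder one
that the calculus produces. -/
theorem JetBound.mono {g : E → F} {x : E} {b₀ b₁ b₂ c₀ c₁ c₂ : ℝ} (h : JetBound g x b₀ b₁ b₂)
    (h₀ : ‖g x‖ ≤ c₀) (h₁ : b₁ ≤ c₁) (h₂ : b₂ ≤ c₂) : JetBound g x c₀ c₁ c₂ := by
  obtain ⟨g', g'', e, d, -, n₁, n₂⟩ := h
  exact ⟨g', g'', e, d, h₀, n₁.trans h₁, n₂.trans h₂⟩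

theorem JetBound.norm_le {g : E → F} {x : E} {b₀ b₁ b₂ : ℝ} (h : JetBound g x b₀ b₁ b₂) :
    ‖g x‖ ≤ b₀ := by
  obtain ⟨g', g'', e, d, n₀, -, -⟩ := h
  exact n₀

theorem JetBound.const (c : F) (x : E) : JetBound (fun _ : E => c) x ‖c‖ 0 0 :=
  ⟨fun _ => 0, 0, Eventually.of_forall fun _ => hasFDerivAt_const _ _, hasFDerivAt_const _ _,
    le_rfl, by simp, by simp⟩

theorem JetBound.clm (A : E →L[ℝ] F) (x : E) : JetBound A x ‖A x‖ ‖A‖ 0 :=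
  ⟨fun _ => A, 0, Eventually.of_forall fun _ => A.hasFDerivAt, hasFDerivAt_const _ _,
    le_rfl, le_rfl, by simp⟩

/-- Second-order chain rule: `(g ∘ f)'' = g''(f', f') + g' f''`. -/
theorem JetBound.comp {g : F → G} {f : E → F} {x : E} {b₀ b₁ b₂ c₀ c₁ c₂ : ℝ}
    (hg : JetBound g (f x) c₀ c₁ c₂) (hf : JetBound f x b₀ b₁ b₂) :
    JetBound (fun y => g (f y)) x c₀ (c₁ * b₁) (c₂ * b₁ ^ 2 + c₁ * b₂) := by
  obtain ⟨g', g'', eg, dg, ng₀, ng₁, ng₂⟩ := hg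
  obtain ⟨f', f'', ef, df, nf₀, nf₁, nf₂⟩ := hf
  have hfx := ef.self_of_nhds
  have p₁ : 0 ≤ b₁ := (norm_nonneg _).trans nf₁
  have q₁ : 0 ≤ c₁ := (norm_nonneg _).trans ng₁
  have q₂ : 0 ≤ c₂ := (norm_nonneg _).trans ng₂
  have p₂ : 0 ≤ b₂ := (norm_nonneg _).trans nf₂
  refine ⟨fun y => (g' (f y)).comp (f' y), _, ?_, (dg.comp x hfx).clm_comp df, ng₀, ?_, ?_⟩
  · filter_upwards [ef, hfx.continuousAt.eventually eg] with y hy hy'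
    exact hy'.comp y hy
  · exact (ContinuousLinearMap.opNorm_comp_le _ _).trans (by gcongr)
  · refine ContinuousLinearMap.opNorm_le_bound₂ _ (by positivity) fun ξ η => ?_
    have e₁ : ‖g'' (f' x ξ) (f' x η)‖ ≤ c₂ * (b₁ * ‖ξ‖) * (b₁ * ‖η‖) :=
      (ContinuousLinearMap.le_opNorm₂ _ _ _).trans (by
        gcongr
        · exact (f' x).le_of_opNorm_le nf₁ ξ
        · exact (f' x).le_of_opNorm_le nf₁ η)
    have e₂ : ‖g' (f x) (f'' ξ η)‖ ≤ c₁ * (b₂ * ‖ξ‖ * ‖η‖) :=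
      ((g' (f x)).le_of_opNorm_le ng₁ _).trans (by
        gcongr
        exact (ContinuousLinearMap.le_opNorm₂ _ _ _).trans (by gcongr))
    have e₃ := norm_add_le (g' (f x) (f'' ξ η)) (g'' (f' x ξ) (f' x η))
    change ‖g' (f x) (f'' ξ η) + g'' (f' x ξ) (f' x η)‖ ≤ _
    linarith

theorem JetBound.bilin (B : F →L[ℝ] G →L[ℝ] H) (hB : ‖B‖ ≤ 1) {f : E → F} {g : E → G} {x : E}
    {b₀ b₁ b₂ c₀ c₁ c₂ : ℝ} (hf : JetBound f x b₀ b₁ b₂) (hg : JetBound g x c₀ c₁ c₂) :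
    JetBound (fun y => B (f y) (g y)) x (b₀ * c₀) (b₁ * c₀ + b₀ * c₁)
      (b₂ * c₀ + 2 * (b₁ * c₁) + b₀ * c₂) := by
  obtain ⟨f', f'', ef, df, nf₀, nf₁, nf₂⟩ := hf
  obtain ⟨g', g'', eg, dg, ng₀, ng₁, ng₂⟩ := hg
  have hfx := ef.self_of_nhds
  have hgx := eg.self_of_nhds
  have p₀ : 0 ≤ b₀ := (norm_nonneg _).trans nf₀
  have p₁ : 0 ≤ b₁ := (norm_nonneg _).trans nf₁
  have p₂ : 0 ≤ b₂ := (norm_nonneg _).trans nf₂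
  have q₀ : 0 ≤ c₀ := (norm_nonneg _).trans ng₀
  have q₁ : 0 ≤ c₁ := (norm_nonneg _).trans ng₁
  have q₂ : 0 ≤ c₂ := (norm_nonneg _).trans ng₂
  have key : ∀ (u : F) (v : G) (a b : ℝ), ‖u‖ ≤ a → ‖v‖ ≤ b → ‖B u v‖ ≤ a * b := by
    intro u v a b hu hv
    have ha : 0 ≤ a := (norm_nonneg _).trans hu
    calc ‖B u v‖ ≤ ‖B‖ * ‖u‖ * ‖v‖ := B.le_opNorm₂ u v
      _ ≤ 1 * a * b := by gcongr
      _ = a * b := by ring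
  refine ⟨fun y => B.precompR E (f y) (g' y) + B.precompL E (f' y) (g y), _, ?_,
    ((B.precompR E).hasFDerivAt_of_bilinear hfx dg).add
      ((B.precompL E).hasFDerivAt_of_bilinear df hgx), key _ _ _ _ nf₀ ng₀, ?_, ?_⟩
  · filter_upwards [ef, eg] with y hy hy'
    exact B.hasFDerivAt_of_bilinear hy hy'
  · refine ContinuousLinearMap.opNorm_le_bound _ (by positivity) fun ξ => ?_
    have e₁ := key (f' x ξ) (g x) _ _ ((f' x).le_of_opNorm_le nf₁ ξ) ng₀
    have e₂ := key (f x) (g' x ξ) _ _ nf₀ ((g' x).le_of_opNorm_le ng₁ ξ)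
    have e₃ := norm_add_le (B (f x) (g' x ξ)) (B (f' x ξ) (g x))
    change ‖B (f x) (g' x ξ) + B (f' x ξ) (g x)‖ ≤ _
    linarith
  · refine ContinuousLinearMap.opNorm_le_bound₂ _ (by positivity) fun ξ η => ?_
    have e₁ := key (f'' ξ η) (g x) (b₂ * ‖ξ‖ * ‖η‖) _
      ((ContinuousLinearMap.le_opNorm₂ _ _ _).trans (by gcongr)) ng₀
    have e₂ := key (f x) (g'' ξ η) _ (c₂ * ‖ξ‖ * ‖η‖) nf₀
      ((ContinuousLinearMap.le_opNorm₂ _ _ _).trans (by gcongr))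
    have e₃ := key (f' x ξ) (g' x η) _ _ ((f' x).le_of_opNorm_le nf₁ ξ)
      ((g' x).le_of_opNorm_le ng₁ η)
    have e₄ := key (f' x η) (g' x ξ) _ _ ((f' x).le_of_opNorm_le nf₁ η)
      ((g' x).le_of_opNorm_le ng₁ ξ)
    have e₅ := norm_add₄_le (a := B (f x) (g'' ξ η)) (b := B (f' x ξ) (g' x η))
      (c := B (f' x η) (g' x ξ)) (d := B (f'' ξ η) (g x))
    rw [show ∀ a b c d : H, ‖a + b + c + d‖ = ‖(a + b) + (c + d)‖ from
      fun a b c d => by rw [add_assoc (a + b)]] at e₅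
    change ‖(B (f x) (g'' ξ η) + B (f' x ξ) (g' x η)) +
      (B (f' x η) (g' x ξ) + B (f'' ξ η) (g x))‖ ≤ _
    linarith

theorem JetBound.const_smul {g : E → F} {x : E} {b₀ b₁ b₂ : ℝ} (h : JetBound g x b₀ b₁ b₂)
    {s : ℝ} (hs : 0 ≤ s) :
    JetBound (fun y => s • g y) x (s * b₀) (s * b₁) (s * b₂) := by
  obtain ⟨g', g'', e, d, n₀, n₁, n₂⟩ := h
  refine ⟨fun y => s • g' y, s • g'', ?_, d.const_smul s, ?_, ?_, ?_⟩
  · filter_upwards [e] with y hy using hy.const_smul s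
  all_goals rw [norm_smul, Real.norm_of_nonneg hs]; gcongr

theorem jetBound_of_hasDerivAt {h h' : ℝ → ℝ} {h'' t b₀ b₁ b₂ : ℝ}
    (e : ∀ᶠ s in 𝓝 t, HasDerivAt h (h' s) s) (d : HasDerivAt h' h'' t)
    (n₀ : |h t| ≤ b₀) (n₁ : |h' t| ≤ b₁) (n₂ : |h''| ≤ b₂) : JetBound h t b₀ b₁ b₂ := by
  have d' := ((ContinuousLinearMap.toSpanSingletonCLE (𝕜 := ℝ) (E := ℝ) :
    ℝ →L[ℝ] ℝ →L[ℝ] ℝ).hasFDerivAt (x := h' t)).comp t d.hasFDerivAt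
  refine ⟨fun s => ContinuousLinearMap.toSpanSingleton ℝ (h' s), _, ?_, d', n₀, ?_, ?_⟩
  · filter_upwards [e] with s hs using hs.hasFDerivAt
  · simpa using n₁
  · refine ContinuousLinearMap.opNorm_le_bound₂ _ ((abs_nonneg _).trans n₂) fun ξ η => ?_
    simp
    nlinarith [mul_le_mul_of_nonneg_right n₂ (mul_nonneg (abs_nonneg ξ) (abs_nonneg η))]

end Jets

/-! ### Normalizing a vector -/

section Normalize

variable {F : Type*} [NormedAddCommGroup F] [InnerProductSpace ℝ F]

theorem jetBound_rpow_neg_half {r : ℝ} (hr : 0 < r) :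
    JetBound (fun t : ℝ => t ^ (-1 / 2 : ℝ)) (r ^ 2) (1 / r) (1 / (2 * r ^ 3))
      (3 / (4 * r ^ 5)) := by
  have hpow : ∀ (k : ℕ) (p : ℝ), p = -(k : ℝ) / 2 → (r ^ 2) ^ p = 1 / r ^ k := by
    intro k p hp
    rw [← Real.rpow_natCast r 2, ← Real.rpow_mul hr.le, hp, one_div, ← Real.rpow_natCast r k,
      ← Real.rpow_neg hr.le]
    congr 1
    push_cast
    ring
  have hr2 : (0 : ℝ) < r ^ 2 := by positivity
  refine jetBound_of_hasDerivAt (h' := fun t => (-1 / 2 : ℝ) * t ^ ((-1 / 2 : ℝ) - 1))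
    (h'' := (-1 / 2 : ℝ) * (((-1 / 2 : ℝ) - 1) * (r ^ 2) ^ ((-1 / 2 : ℝ) - 1 - 1))) ?_ ?_ ?_ ?_ ?_
  · filter_upwards [lt_mem_nhds hr2] with t ht
    exact Real.hasDerivAt_rpow_const (Or.inl ht.ne')
  · exact (Real.hasDerivAt_rpow_const (Or.inl hr2.ne')).const_mul _
  · rw [hpow 1 _ (by norm_num), abs_of_pos (by positivity), pow_one]
  · rw [hpow 3 _ (by norm_num), abs_mul, abs_of_neg (by norm_num : (-1 / 2 : ℝ) < 0),
      abs_of_pos (by positivity)]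
    apply le_of_eq
    field_simp
  · rw [hpow 5 _ (by norm_num), ← mul_assoc, abs_of_pos (by norm_num; positivity)]
    apply le_of_eq
    field_simp
    norm_num

theorem jetBound_id (x : F) : JetBound (fun y : F => y) x ‖x‖ 1 0 :=
  (JetBound.clm (ContinuousLinearMap.id ℝ F) x).mono le_rfl ContinuousLinearMap.norm_id_le le_rfl

theorem jetBound_inner_self (x : F) :
    JetBound (fun y : F => (inner ℝ y y : ℝ)) x (‖x‖ ^ 2) (2 * ‖x‖) 2 := by
  have h := JetBound.bilin (innerSL ℝ) (norm_innerSL_le ℝ) (jetBound_id x) (jetBound_id x)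
  exact h.mono (h.norm_le.trans_eq (sq _).symm) (by linarith)
    (by linarith)

/-- Write `‖y‖⁻¹` as `⟨y, y⟩ ^ (-1/2)`. With `r = ‖x‖` its derivatives are at most `1 / r ^ 2` and
`4 / r ^ 3`; multiplying by `y` gives `1/r + 1/r` and `4/r² + 2/r²`. -/
theorem jetBound_normalize {x : F} (hx : x ≠ 0) :
    JetBound (fun y : F => ‖y‖⁻¹ • y) x 1 (2 / ‖x‖) (6 / ‖x‖ ^ 2) := by
  have hr : 0 < ‖x‖ := norm_pos_iff.2 hx
  have h₁ := jetBound_rpow_neg_half hr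
  rw [← real_inner_self_eq_norm_sq x] at h₁
  have h₂ := h₁.comp (f := fun y : F => (inner ℝ y y : ℝ)) (jetBound_inner_self x)
  have h₃ := JetBound.bilin (ContinuousLinearMap.lsmul ℝ ℝ)
    (ContinuousLinearMap.opNorm_lsmul_le) h₂ (jetBound_id x)
  have e : (fun y : F => ‖y‖⁻¹ • y) = fun y : F =>
      ContinuousLinearMap.lsmul ℝ ℝ ((inner ℝ y y : ℝ) ^ (-1 / 2 : ℝ)) y := by
    funext y
    rw [ContinuousLinearMap.lsmul_apply, real_inner_self_eq_norm_sq, ← Real.rpow_natCast,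
      ← Real.rpow_mul (norm_nonneg _)]
    norm_num [Real.rpow_neg_one]
  rw [e]
  refine h₃.mono ?_ (le_of_eq ?_) (le_of_eq ?_)
  · refine h₃.norm_le.trans (le_of_eq ?_)
    field_simp
  · field_simp
    norm_num
  · field_simp
    norm_num

end Normalize

/-! ### Coordinatewise maps on `ℓ²` products -/

section Pi

variable {F G : Type*} [NormedAddCommGroup F] [NormedAddCommGroup G] {ι : Type*} [Fintype ι]

theorem piLp_norm_le_of_forall_le {u : PiLp 2 fun _ : ι => G} {w : PiLp 2 fun _ : ι => F} {b : ℝ}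
    (hb : 0 ≤ b) (h : ∀ i, ‖u i‖ ≤ b * ‖w i‖) : ‖u‖ ≤ b * ‖w‖ := by
  refine le_of_sq_le_sq ?_ (by positivity)
  rw [mul_pow, PiLp.norm_sq_eq_of_L2, PiLp.norm_sq_eq_of_L2, Finset.mul_sum]
  refine Finset.sum_le_sum fun i _ => ?_
  rw [← mul_pow]
  exact pow_le_pow_left₀ (norm_nonneg _) (h i) 2

variable [NormedSpace ℝ F] [NormedSpace ℝ G]

/-- The coordinatewise action of a family of operators. -/
noncomputable def diagCLM [DecidableEq ι] :
    (ι → F →L[ℝ] G) →L[ℝ] (PiLp 2 fun _ : ι => F) →L[ℝ] PiLp 2 fun _ : ι => G :=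
  ∑ i, ((ContinuousLinearMap.compL ℝ (PiLp 2 fun _ : ι => F) F (PiLp 2 fun _ : ι => G)).flip
      (PiLp.proj 2 (fun _ : ι => F) i)).comp
    (((ContinuousLinearMap.compL ℝ F G (PiLp 2 fun _ : ι => G))
      (((PiLp.continuousLinearEquiv 2 ℝ fun _ : ι => G).symm : (ι → G) →L[ℝ] _).comp
        (ContinuousLinearMap.single ℝ (fun _ : ι => G) i))).comp
      (ContinuousLinearMap.proj i))

theorem diagCLM_apply [DecidableEq ι] (A : ι → F →L[ℝ] G) (u : PiLp 2 fun _ : ι => F) (i : ι) :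
    diagCLM A u i = A i (u i) := by
  simp only [diagCLM, _root_.sum_apply]
  rw [WithLp.ofLp_sum, Finset.sum_apply, Finset.sum_eq_single i]
  · change Pi.single (M := fun _ : ι => G) i (A i (u i)) i = _
    simp
  · intro j _ hj
    change Pi.single (M := fun _ : ι => G) j (A j (u j)) i = _
    rw [Pi.single_eq_of_ne hj.symm]
  · simp

/-- Both derivatives act diagonally, so their norms are governed by the worst coordinate and carry
no factor of the dimension. -/
theorem jetBound_pi {g : F → G} {x : PiLp 2 fun _ : ι => F} {b₀ b₁ b₂ : ℝ}
    (hb₁ : 0 ≤ b₁) (hb₂ : 0 ≤ b₂)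
    (h : ∀ i, JetBound g (x i) b₀ b₁ b₂) :
    JetBound (fun y : PiLp 2 fun _ : ι => F => (WithLp.toLp 2 fun i => g (y i) :
      PiLp 2 fun _ : ι => G)) x ‖(WithLp.toLp 2 fun i => g (x i) : PiLp 2 fun _ : ι => G)‖ b₁ b₂ := by
  classical
  choose g' g'' e d n₀ n₁ n₂ using h
  have hproj : ∀ (i : ι) (y : PiLp 2 fun _ : ι => F),
      HasFDerivAt (fun y : PiLp 2 fun _ : ι => F => y i) (PiLp.proj 2 (fun _ : ι => F) i) y :=
    fun i y => (PiLp.proj (𝕜 := ℝ) 2 (fun _ : ι => F) i).hasFDerivAt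
  refine ⟨fun y => diagCLM fun i => g' i (y i), _, ?_,
    (diagCLM (F := F) (G := G) (ι := ι)).hasFDerivAt.comp x (hasFDerivAt_pi.2 fun i =>
      (d i).comp x (hproj i x)), le_rfl, ?_, ?_⟩
  · have : ∀ᶠ y in 𝓝 x, ∀ i, HasFDerivAt g (g' i (y i)) (y i) :=
      eventually_all.2 fun i => (hproj i x).continuousAt.eventually (e i)
    filter_upwards [this] with y hy
    have h₁ : HasFDerivAt (fun y : PiLp 2 fun _ : ι => F => fun i => g (y i))
        (ContinuousLinearMap.pi fun i => (g' i (y i)).comp (PiLp.proj 2 (fun _ : ι => F) i)) y :=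
      hasFDerivAt_pi.2 fun i => (hy i).comp y (hproj i y)
    have h₂ := ((PiLp.continuousLinearEquiv 2 ℝ fun _ : ι => G).symm :
      (ι → G) →L[ℝ] PiLp 2 fun _ : ι => G).hasFDerivAt.comp y h₁
    refine h₂.congr_fderiv ?_
    ext η i
    exact (diagCLM_apply (fun i => g' i (y i)) η i).symm
  · refine ContinuousLinearMap.opNorm_le_bound _ hb₁ fun η =>
      piLp_norm_le_of_forall_le hb₁ fun i => ?_
    rw [diagCLM_apply]
    exact (g' i (x i)).le_of_opNorm_le (n₁ i) _
  · refine ContinuousLinearMap.opNorm_le_bound₂ _ hb₂ fun ξ η =>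
      piLp_norm_le_of_forall_le (by positivity) fun i => ?_
    -- One argument is measured in the sup norm, the other is kept for the `ℓ²` sum.
    have : ‖g'' i (ξ i) (η i)‖ ≤ b₂ * ‖ξ‖ * ‖η i‖ :=
      (ContinuousLinearMap.le_opNorm₂ _ _ _).trans (by
        gcongr
        · exact n₂ i
        · exact PiLp.norm_apply_le ξ i)
    refine le_of_eq_of_le ?_ this
    exact congrArg norm (diagCLM_apply _ _ _)

end Pi

/-! ### Matrix-vector product in the Frobenius norm -/

section MatVec

variable {F : Type*} [NormedAddCommGroup F] [InnerProductSpace ℝ F] {ι : Type*} [Fintype ι]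

/-- The product of the matrix with the given rows and a vector. -/
noncomputable def rowsMul : (PiLp 2 fun _ : ι => F) →L[ℝ] F →L[ℝ] EuclideanSpace ℝ ι :=
  LinearMap.mkContinuous₂
    (LinearMap.mk₂ ℝ (fun (U : PiLp 2 fun _ : ι => F) (a : F) =>
        (WithLp.toLp 2 fun i => inner ℝ (U i) a : EuclideanSpace ℝ ι))
      (fun U V a => by ext i; simp [inner_add_left])
      (fun c U a => by ext i; simp [inner_smul_left])
      (fun U a b => by ext i; simp [inner_add_right])
      (fun c U a => by ext i; simp [inner_smul_right]))
    1 fun U a => by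
      rw [one_mul, mul_comm]
      exact piLp_norm_le_of_forall_le (norm_nonneg _) fun i => by
        rw [mul_comm]
        exact norm_inner_le_norm _ _

theorem rowsMul_apply (U : PiLp 2 fun _ : ι => F) (a : F) (i : ι) :
    rowsMul U a i = inner ℝ (U i) a := rfl

theorem norm_rowsMul_le : ‖(rowsMul : (PiLp 2 fun _ : ι => F) →L[ℝ] F →L[ℝ] _)‖ ≤ 1 :=
  LinearMap.mkContinuous₂_norm_le _ zero_le_one _

end MatVec

/-! ### A single layer -/

section Layer

variable {E F : Type*} [NormedAddCommGroup E] [NormedSpace ℝ E]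
  [NormedAddCommGroup F] [InnerProductSpace ℝ F] {ι : Type*} [Fintype ι]

theorem norm_toLp_le_sqrt_card {G : Type*} [NormedAddCommGroup G] {u : ι → G} {c : ℝ} (hc : 0 ≤ c)
    (h : ∀ i, ‖u i‖ ≤ c) :
    ‖(WithLp.toLp 2 u : PiLp 2 fun _ : ι => G)‖ ≤ c * √(Fintype.card ι) := by
  refine le_of_sq_le_sq ?_ (by positivity)
  rw [PiLp.norm_sq_eq_of_L2, mul_pow, Real.sq_sqrt (by positivity)]
  calc ∑ i, ‖u i‖ ^ 2 ≤ ∑ _i : ι, c ^ 2 :=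
        Finset.sum_le_sum fun i _ => pow_le_pow_left₀ (norm_nonneg _) (h i) 2
    _ = c ^ 2 * Fintype.card ι := by simp [mul_comm]

theorem jetBound_normalizeRows {A : E →L[ℝ] PiLp 2 fun _ : ι => F} (hA : ‖A‖ ≤ 1) {θ : E} {w : ℝ}
    (hw : 0 < w) (h : ∀ i, w ≤ ‖A θ i‖) :
    JetBound (fun y => (WithLp.toLp 2 fun i => ‖A y i‖⁻¹ • A y i : PiLp 2 fun _ : ι => F)) θ
      (√(Fintype.card ι)) (2 / w) (6 / w ^ 2) := by
  have h₁ : ∀ i, JetBound (fun u : F => ‖u‖⁻¹ • u) (A θ i) 1 (2 / w) (6 / w ^ 2) := fun i => by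
    have h₀ := jetBound_normalize (norm_pos_iff.1 (hw.trans_le (h i)))
    refine h₀.mono h₀.norm_le ?_ ?_
    · have := h i
      gcongr
    · have := h i
      gcongr
  have h₂ := (jetBound_pi (by positivity) (by positivity) h₁).comp (JetBound.clm A θ)
  refine h₂.mono ?_ ?_ ?_
  · simpa using norm_toLp_le_sqrt_card zero_le_one fun i => (h₁ i).norm_le
  · exact mul_le_of_le_one_right (by positivity) hA
  · rw [mul_zero, add_zero]
    exact mul_le_of_le_one_right (by positivity) (pow_le_one₀ (norm_nonneg _) hA)

variable {φ : ℝ → ℝ} {β : ℝ}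

theorem abs_le_of_abs_deriv_le_one (hφ : Differentiable ℝ φ) (h₁ : ∀ t, |deriv φ t| ≤ 1) (t : ℝ) :
    |φ t| ≤ |φ 0| + |t| := by
  have h := Convex.norm_image_sub_le_of_norm_deriv_le (f := φ) (C := 1) (s := Set.univ)
    (fun x _ => hφ x) (fun x _ => h₁ x) convex_univ (Set.mem_univ 0) (Set.mem_univ t)
  simp only [Real.norm_eq_abs, sub_zero, one_mul] at h
  have := abs_add_le (φ 0) (φ t - φ 0)
  rw [add_sub_cancel] at this
  linarith

/-- Coordinatewise comparison with `|φ 0| + |z i|`: only the constant part costs a factor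
`√(Fintype.card ι)`. -/
theorem norm_activation_le (hφ : Differentiable ℝ φ) (h₁ : ∀ t, |deriv φ t| ≤ 1)
    (z : EuclideanSpace ℝ ι) :
    ‖(WithLp.toLp 2 fun i => φ (z i) : EuclideanSpace ℝ ι)‖ ≤
      |φ 0| * √(Fintype.card ι) + ‖z‖ := by
  set u : EuclideanSpace ℝ ι := WithLp.toLp 2 fun _ => |φ 0|
  set v : EuclideanSpace ℝ ι := WithLp.toLp 2 fun i => |z i|
  have hu : ‖u‖ ≤ |φ 0| * √(Fintype.card ι) :=
    norm_toLp_le_sqrt_card (abs_nonneg _) fun i => by simp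
  have hv : ‖v‖ ≤ 1 * ‖z‖ := piLp_norm_le_of_forall_le zero_le_one fun i => by simp [v]
  have huv : ‖(WithLp.toLp 2 fun i => φ (z i) : EuclideanSpace ℝ ι)‖ ≤ 1 * ‖u + v‖ :=
    piLp_norm_le_of_forall_le zero_le_one fun i => by
      have h₀ : 0 ≤ |φ 0| + |z i| := by positivity
      simpa [u, v, abs_of_nonneg h₀] using abs_le_of_abs_deriv_le_one hφ h₁ (z i)
  linarith [norm_add_le u v]

theorem jetBound_activation (hφ : Differentiable ℝ φ) (hφ' : Differentiable ℝ (deriv φ))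
    (h₁ : ∀ t, |deriv φ t| ≤ 1) (h₂ : ∀ t, |deriv (deriv φ) t| ≤ β) (z : EuclideanSpace ℝ ι) :
    JetBound (fun y : EuclideanSpace ℝ ι =>
      (WithLp.toLp 2 fun i => φ (y i) : EuclideanSpace ℝ ι)) z
      (|φ 0| * √(Fintype.card ι) + ‖z‖) 1 β := by
  have hβ : 0 ≤ β := (abs_nonneg _).trans (h₂ 0)
  have hΦ : ∀ i, JetBound φ (z i) (|φ 0| + ‖z‖) 1 β := fun i =>
    jetBound_of_hasDerivAt (Eventually.of_forall fun t => (hφ t).hasDerivAt) (hφ' _).hasDerivAt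
      ((abs_le_of_abs_deriv_le_one hφ h₁ _).trans
        (add_le_add_right (PiLp.norm_apply_le z i) _)) (h₁ _) (h₂ _)
  exact (jetBound_pi zero_le_one hβ hΦ).mono (norm_activation_le hφ h₁ z) le_rfl le_rfl

/-- One layer of a WeightNorm network, the parameters entering through `A` and the input `α`. -/
theorem jetBound_layer (hφ : Differentiable ℝ φ) (hφ' : Differentiable ℝ (deriv φ))
    (h₁ : ∀ t, |deriv φ t| ≤ 1) (h₂ : ∀ t, |deriv (deriv φ) t| ≤ β) [Nonempty ι]
    {A : E →L[ℝ] PiLp 2 fun _ : ι => F} (hA : ‖A‖ ≤ 1) {θ : E} {w : ℝ}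
    (hw : 0 < w) (h : ∀ i, w ≤ ‖A θ i‖) {α : E → F} {a₀ a₁ a₂ : ℝ}
    (hα : JetBound α θ a₀ a₁ a₂) {s : ℝ} (hs : s = 1 / √(Fintype.card ι)) :
    JetBound (fun y => (WithLp.toLp 2 fun i => φ (s * (inner ℝ (A y i) (α y) / ‖A y i‖)) :
      EuclideanSpace ℝ ι)) θ (|φ 0| * √(Fintype.card ι) + a₀) (2 * (s * a₀) / w + a₁)
      (β * (2 * (s * a₀) / w + a₁) ^ 2 + (6 * (s * a₀) / w ^ 2 + 4 * (s * a₁) / w + a₂)) := by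
  have hk : 0 < √(Fintype.card ι : ℝ) := Real.sqrt_pos.2 (by exact_mod_cast Fintype.card_pos)
  have hs₀ : 0 ≤ s := by rw [hs]; positivity
  -- This cancellation gives `a₁` and `a₂` coefficient 1 and so rules out growth exponential in the
  -- depth.
  have hsk : s * √(Fintype.card ι) = 1 := by rw [hs]; field_simp
  have hN := jetBound_normalizeRows hA hw h
  have hB := JetBound.bilin (rowsMul (F := F) (ι := ι)) norm_rowsMul_le hN hα
  have hz := hB.const_smul hs₀
  have hΦz := (jetBound_activation hφ hφ' h₁ h₂ _).comp hz
  have e : (fun y => (WithLp.toLp 2 fun i => φ (s * (inner ℝ (A y i) (α y) / ‖A y i‖)) :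
      EuclideanSpace ℝ ι)) = fun y => WithLp.toLp 2 fun i => φ ((s • rowsMul
        (WithLp.toLp 2 fun i => ‖A y i‖⁻¹ • A y i : PiLp 2 fun _ : ι => F) (α y)) i) := by
    funext y
    congr 1
    funext i
    rw [PiLp.smul_apply, rowsMul_apply, real_inner_smul_left, smul_eq_mul, div_eq_inv_mul]
  rw [e]
  have e₁ : s * (2 / w * a₀ + √(Fintype.card ι) * a₁) = 2 * (s * a₀) / w + a₁ := by
    linear_combination a₁ * hsk
  refine hΦz.mono (hΦz.norm_le.trans ?_) (le_of_eq ?_) (le_of_eq ?_)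
  · have := hz.norm_le
    rw [← mul_assoc, hsk, one_mul] at this
    gcongr
  · rw [e₁, one_mul]
  · rw [e₁]
    linear_combination a₂ * hsk

end Layer

/-! ### Induction over the layers and the output -/

section Network

variable {n : ℕ → ℕ} {L : ℕ}

/-- The rows of one hidden weight matrix, as a linear function of the parameters. -/
noncomputable def rowsCLM (l : Fin L) :
    Param n L →L[ℝ] PiLp 2 fun _ : Fin (n ((l : ℕ) + 1)) => EuclideanSpace ℝ (Fin (n (l : ℕ))) :=
  LinearMap.mkContinuous
    { toFun := fun θ => WithLp.toLp 2 fun i => row θ l i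
      map_add' := fun θ η => by ext i j; rfl
      map_smul' := fun c θ => by ext i j; rfl }
    1 fun θ => by
      rw [one_mul]
      refine le_of_sq_le_sq ?_ (norm_nonneg _)
      rw [PiLp.norm_sq_eq_of_L2, EuclideanSpace.norm_sq_eq, Fintype.sum_sum_type]
      refine le_add_of_le_of_nonneg ?_ (Finset.sum_nonneg fun _ _ => sq_nonneg _)
      rw [Fintype.sum_sigma]
      refine le_trans (le_of_eq ?_) (Finset.single_le_sum
        (f := fun l : Fin L => ∑ p : Fin (n ((l : ℕ) + 1)) × Fin (n (l : ℕ)),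
          ‖θ (Sum.inl ⟨l, p⟩)‖ ^ 2)
        (fun l _ => Finset.sum_nonneg fun _ _ => sq_nonneg _) (Finset.mem_univ l))
      rw [Fintype.sum_prod_type]
      exact Finset.sum_congr rfl fun i _ => EuclideanSpace.norm_sq_eq _

theorem norm_rowsCLM_le (l : Fin L) : ‖(rowsCLM l : Param n L →L[ℝ] _)‖ ≤ 1 :=
  LinearMap.mkContinuous_norm_le _ zero_le_one _

/-- The output vector, as a linear function of the parameters. -/
noncomputable def outVecCLM : Param n L →L[ℝ] EuclideanSpace ℝ (Fin (n L)) :=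
  LinearMap.mkContinuous
    { toFun := outVec
      map_add' := fun θ η => by ext i; rfl
      map_smul' := fun c θ => by ext i; rfl }
    1 fun θ => by
      rw [one_mul]
      refine le_of_sq_le_sq ?_ (norm_nonneg _)
      rw [EuclideanSpace.norm_sq_eq, EuclideanSpace.norm_sq_eq, Fintype.sum_sum_type]
      exact le_add_of_nonneg_left (Finset.sum_nonneg fun _ _ => sq_nonneg _)

theorem norm_outVecCLM_le : ‖(outVecCLM : Param n L →L[ℝ] _)‖ ≤ 1 :=
  LinearMap.mkContinuous_norm_le _ zero_le_one _

/-- The increment per layer is made independent of `l` by replacing `l` with `L` inside it, so the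
derivative bounds are `l` times a constant. -/
theorem jetBound_act {φ : ℝ → ℝ} {β : ℝ} (hφ : Differentiable ℝ φ)
    (hφ' : Differentiable ℝ (deriv φ)) (h₁ : ∀ t, |deriv φ t| ≤ 1)
    (h₂ : ∀ t, |deriv (deriv φ) t| ≤ β) {m : ℕ} (hm : 1 ≤ m)
    (hn : ∀ l, 1 ≤ l → l ≤ L → n l = m) {x : EuclideanSpace ℝ (Fin (n 0))} (hx : ‖x‖ = 1)
    {θ : Param n L} {w : ℝ} (hw : 0 < w)
    (h : ∀ (l : Fin L) (i : Fin (n ((l : ℕ) + 1))), w ≤ ‖row θ l i‖) {a : ℝ}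
    (ha : a = 1 / √(m : ℝ) + L * |φ 0|) (l : ℕ) (hl : l ≤ L) :
    JetBound (fun θ' => act φ θ' x l hl) θ (1 + l * |φ 0| * √(m : ℝ)) (l * (2 * a / w))
      (l * (β * (L * (2 * a / w)) ^ 2 +
        (6 * a / w ^ 2 + 4 * (1 / √(m : ℝ) * (L * (2 * a / w))) / w))) := by
  have hβ : 0 ≤ β := (abs_nonneg _).trans (h₂ 0)
  have hm' : 0 < √(m : ℝ) := Real.sqrt_pos.2 (by exact_mod_cast hm)
  have ha₀ : 0 ≤ a := by rw [ha]; positivity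
  induction l with
  | zero =>
    have := JetBound.const x θ
    refine this.mono ?_ (by simp) (by simp)
    simp [hx]
  | succ l ih =>
    have hnl : n (l + 1) = m := hn (l + 1) (by omega) hl
    have : Nonempty (Fin (n (l + 1))) := ⟨⟨0, by omega⟩⟩
    have hl' : (l : ℝ) ≤ L := by exact_mod_cast (by omega : l ≤ L)
    have hl'' : (l : ℝ) + 1 ≤ L := by exact_mod_cast hl
    have key := jetBound_layer hφ hφ' h₁ h₂ (norm_rowsCLM_le ⟨l, hl⟩) hw
      (h ⟨l, hl⟩) (ih (Nat.le_of_succ_le hl)) (s := 1 / √(n (l + 1) : ℝ)) (by simp)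
    have hsa : 1 / √(n (l + 1) : ℝ) * (1 + l * |φ 0| * √(m : ℝ)) ≤ a := by
      rw [hnl, ha]
      have : 1 / √(m : ℝ) * (1 + l * |φ 0| * √(m : ℝ)) = 1 / √(m : ℝ) + l * |φ 0| := by
        field_simp
      rw [this]
      gcongr
    have hb₁ : 2 * (1 / √(n (l + 1) : ℝ) * (1 + l * |φ 0| * √(m : ℝ))) / w + l * (2 * a / w) ≤
        (l + 1) * (2 * a / w) := by
      rw [add_one_mul, add_comm]
      gcongr
    have hb₁' : ((l : ℝ) + 1) * (2 * a / w) ≤ L * (2 * a / w) := by gcongr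
    refine key.mono (key.norm_le.trans (le_of_eq ?_)) ?_ ?_
    · simp only [Fintype.card_fin, hnl]
      push_cast
      ring
    · push_cast
      exact hb₁
    · push_cast
      rw [add_one_mul, add_comm (_ * _) (β * _ + _)]
      rw [add_assoc (β * _)]
      refine add_le_add (mul_le_mul_of_nonneg_left (pow_le_pow_left₀ (by positivity)
        (hb₁.trans hb₁') 2) hβ) (add_le_add (add_le_add (by gcongr) ?_) le_rfl)
      rw [hnl]
      gcongr

theorem jetBound_predictor {φ : ℝ → ℝ} {β : ℝ} (hφ : Differentiable ℝ φ)
    (hφ' : Differentiable ℝ (deriv φ)) (h₁ : ∀ t, |deriv φ t| ≤ 1)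
    (h₂ : ∀ t, |deriv (deriv φ) t| ≤ β) {m : ℕ} (hm : 1 ≤ m) (hL : 1 ≤ L)
    (hn : ∀ l, 1 ≤ l → l ≤ L → n l = m) {x : EuclideanSpace ℝ (Fin (n 0))} (hx : ‖x‖ = 1)
    {θ : Param n L} {w : ℝ} (hw : 0 < w)
    (h : ∀ (l : Fin L) (i : Fin (n ((l : ℕ) + 1))), w ≤ ‖row θ l i‖) {ρ : ℝ} (hρ : 0 ≤ ρ)
    (hv : ‖outVec θ‖ ≤ 1 + ρ) :
    ∃ b₀ b₁, JetBound (predictor φ x) θ b₀ b₁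
      ((8 * β + 18) * (((1 + ρ) * (L : ℝ) ^ 3 *
        (1 / √(m : ℝ) + (L : ℝ) ^ 2 * max |φ 0| (|φ 0| ^ 2))) / min w (w ^ 2))) := by
  have hβ : 0 ≤ β := (abs_nonneg _).trans (h₂ 0)
  have hα := jetBound_act hφ hφ' h₁ h₂ hm hn hx hw h rfl L le_rfl
  have hv' : JetBound (outVecCLM : Param n L →L[ℝ] _) θ (1 + ρ) 1 0 :=
    (JetBound.clm outVecCLM θ).mono hv norm_outVecCLM_le le_rfl
  have hf := JetBound.bilin (innerSL ℝ) (norm_innerSL_le ℝ) hv' hα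
  refine ⟨_, _, hf.mono hf.norm_le le_rfl ?_⟩
  set s := 1 / √(m : ℝ)
  set c := |φ 0|
  set T := s + (L : ℝ) ^ 2 * max c (c ^ 2)
  have hm' : 1 ≤ √(m : ℝ) := Real.one_le_sqrt.2 (by exact_mod_cast hm)
  have hs₀ : 0 ≤ s := by positivity
  have hs₁ : s ≤ 1 := (div_le_one (by positivity)).2 hm'
  have hc : 0 ≤ c := abs_nonneg _
  have hL' : (1 : ℝ) ≤ L := by exact_mod_cast hL
  have hL₀ : (0 : ℝ) ≤ L := by linarith
  have hLL : (L : ℝ) ≤ (L : ℝ) ^ 2 := by nlinarith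
  have hLLL : (L : ℝ) ≤ (L : ℝ) ^ 3 := by nlinarith
  have hM₁ : (L : ℝ) ^ 2 * c ≤ (L : ℝ) ^ 2 * max c (c ^ 2) := by gcongr; exact le_max_left _ _
  have hM₂ : (L : ℝ) ^ 2 * c ^ 2 ≤ (L : ℝ) ^ 2 * max c (c ^ 2) := by gcongr; exact le_max_right _ _
  have hLc : (L : ℝ) * c ≤ (L : ℝ) ^ 2 * c := by gcongr
  have haT : s + L * c ≤ T := by linarith
  have ha₀ : 0 ≤ s + L * c := by positivity
  have hT : 0 ≤ T := ha₀.trans haT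
  -- Uses `s ^ 2 ≤ s` and `(s + L c)² ≤ 2 s² + 2 L² c²`; the square of `|φ 0|` in the theorem comes
  -- from here.
  have ha2 : (s + L * c) ^ 2 ≤ 2 * T := by nlinarith [sq_nonneg (s - L * c)]
  have hsa : s * (s + L * c) ≤ T := (mul_le_of_le_one_left ha₀ hs₁).trans haT
  set μ := min w (w ^ 2)
  have hμ : 0 < μ := lt_min hw (by positivity)
  have hμ₁ : 1 / w ≤ 1 / μ := one_div_le_one_div_of_le hμ (min_le_left _ _)
  have hμ₂ : 1 / w ^ 2 ≤ 1 / μ := one_div_le_one_div_of_le hμ (min_le_right _ _)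
  have k₁ : L * (2 * (s + L * c) / w) ≤ 2 * ((L : ℝ) ^ 3 * T) * (1 / μ) :=
    calc L * (2 * (s + L * c) / w) = 2 * (L * (s + L * c)) * (1 / w) := by ring
      _ ≤ 2 * ((L : ℝ) ^ 3 * T) * (1 / μ) := by gcongr
  -- `8 β` is `4 β` times the 2 of `ha2`, and `14 = 6 + 8`. Summing over the layers supplies the
  -- third power of `L`.
  have k₂ : β * (L * (2 * (s + L * c) / w)) ^ 2 +
      (6 * (s + L * c) / w ^ 2 + 4 * (s * (L * (2 * (s + L * c) / w))) / w) ≤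
      (8 * β + 14) * ((L : ℝ) ^ 2 * T) * (1 / μ) :=
    calc _ = (4 * β * ((L : ℝ) ^ 2 * (s + L * c) ^ 2) +
          (6 * (1 * (s + L * c)) + 8 * (L * (s * (s + L * c))))) * (1 / w ^ 2) := by
            field_simp
            ring
      _ ≤ (4 * β * ((L : ℝ) ^ 2 * (2 * T)) +
          (6 * ((L : ℝ) ^ 2 * T) + 8 * ((L : ℝ) ^ 2 * T))) * (1 / μ) := by
            gcongr
            exact hL'.trans hLL
      _ = _ := by ring
  have hK : 0 ≤ (L : ℝ) ^ 3 * T * (1 / μ) := by positivity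
  calc 0 * (1 + L * c * √(m : ℝ)) + 2 * (1 * (L * (2 * (s + L * c) / w))) +
        (1 + ρ) * (L * (β * (L * (2 * (s + L * c) / w)) ^ 2 +
          (6 * (s + L * c) / w ^ 2 + 4 * (s * (L * (2 * (s + L * c) / w))) / w)))
      ≤ 0 * (1 + L * c * √(m : ℝ)) + 2 * (1 * (2 * ((L : ℝ) ^ 3 * T) * (1 / μ))) +
        (1 + ρ) * (L * ((8 * β + 14) * ((L : ℝ) ^ 2 * T) * (1 / μ))) := by gcongr
    _ = (4 + (1 + ρ) * (8 * β + 14)) * ((L : ℝ) ^ 3 * T * (1 / μ)) := by ring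
    -- The 4 from the mixed derivatives in `v` and the weights is absorbed using `1 ≤ 1 + ρ`.
    _ ≤ ((1 + ρ) * (8 * β + 18)) * ((L : ℝ) ^ 3 * T * (1 / μ)) := by
        gcongr
        linarith
    _ = _ := by ring

end Network

/-! ### From second derivative to Hessian -/

section Hessian

variable {V : Type*} [NormedAddCommGroup V] [InnerProductSpace ℝ V] [CompleteSpace V]

/-- The Riesz representation as a linear isometry, over the reals. -/
noncomputable def rieszLI : (V →L[ℝ] ℝ) →ₗᵢ[ℝ] V where
  toFun := (InnerProductSpace.toDual ℝ V).symm
  map_add' := map_add _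
  map_smul' c u := by
    rw [LinearIsometryEquiv.map_smulₛₗ]
    simp
  norm_map' := (InnerProductSpace.toDual ℝ V).symm.norm_map

theorem JetBound.gradient {g : V → ℝ} {x : V} {b₀ b₁ b₂ : ℝ} (h : JetBound g x b₀ b₁ b₂) :
    (∀ᶠ y in 𝓝 x, DifferentiableAt ℝ g y) ∧ DifferentiableAt ℝ (_root_.gradient g) x ∧
      ‖fderiv ℝ (_root_.gradient g) x‖ ≤ b₂ := by
  obtain ⟨g', g'', e, d, -, -, n₂⟩ := h
  have hg : HasFDerivAt (_root_.gradient g)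
      ((rieszLI (V := V)).toContinuousLinearMap.comp g'') x := by
    refine ((rieszLI (V := V)).toContinuousLinearMap.hasFDerivAt.comp x d).congr_of_eventuallyEq ?_
    filter_upwards [e] with y hy
    simp only [_root_.gradient, hy.fderiv]
    rfl
  refine ⟨e.mono fun y hy => hy.differentiableAt, hg.differentiableAt, ?_⟩
  rw [hg.fderiv, LinearIsometry.norm_toContinuousLinearMap_comp]
  exact n₂

end Hessian

end WeightNorm

theorem mainTheorem1 (β : ℝ) :
    ∃ C : ℝ, 0 < C ∧
      ∀ (φ : ℝ → ℝ),
        Differentiable ℝ φ → Differentiable ℝ (deriv φ) →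
        (∀ t, |deriv φ t| ≤ 1) → (∀ t, |deriv (deriv φ) t| ≤ β) →
      ∀ (n : ℕ → ℕ) (L m : ℕ), 1 ≤ L → 1 ≤ m → (∀ l, 1 ≤ l → l ≤ L → n l = m) →
      ∀ (v₀ : EuclideanSpace ℝ (Fin (n L))), ‖v₀‖ = 1 →
      ∀ (x : EuclideanSpace ℝ (Fin (n 0))), ‖x‖ = 1 →
      ∀ (ρ₁ : ℝ) (θ : WeightNorm.Param n L),
        WeightNorm.outVec θ ∈ Metric.closedBall v₀ ρ₁ →
        (∀ (l : Fin L) (i : Fin (n ((l : ℕ) + 1))), WeightNorm.row θ l i ≠ 0) →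
        (∀ᶠ θ' in nhds θ, DifferentiableAt ℝ (WeightNorm.predictor φ x) θ') ∧
        DifferentiableAt ℝ (gradient (WeightNorm.predictor φ x)) θ ∧
        ‖WeightNorm.hessian (WeightNorm.predictor φ x) θ‖ ≤
          C * (((1 + ρ₁) * (L : ℝ) ^ 3 *
              (1 / √(m : ℝ) + (L : ℝ) ^ 2 * max |φ 0| (|φ 0| ^ 2))) /
            min (WeightNorm.minRowNorm θ) (WeightNorm.minRowNorm θ ^ 2)) := by
  -- The absolute value keeps the constant positive for negative `β`, where no `φ` qualifies.
  refine ⟨8 * |β| + 18, by positivity, ?_⟩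
  intro φ hφ hφ' h₁ h₂ n L m hL hm hn v₀ hv₀ x hx ρ θ hθ hrow
  have hβ : 0 ≤ β := (abs_nonneg _).trans (h₂ 0)
  have hn₁ : n 1 = m := hn 1 le_rfl hL
  have : Nonempty (Σ l : Fin L, Fin (n ((l : ℕ) + 1))) :=
    ⟨⟨⟨0, hL⟩, ⟨0, by simp only [zero_add, hn₁]; exact hm⟩⟩⟩
  have hdist : ‖WeightNorm.outVec θ - v₀‖ ≤ ρ := mem_closedBall_iff_norm.1 hθ
  have hρ : 0 ≤ ρ := (norm_nonneg _).trans hdist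
  have hv : ‖WeightNorm.outVec θ‖ ≤ 1 + ρ := by
    have := norm_le_norm_add_norm_sub' (WeightNorm.outVec θ) v₀
    linarith
  -- The minimum is attained at some row, hence positive.
  obtain ⟨p, hp⟩ := exists_eq_ciInf_of_finite
    (f := fun p : Σ l : Fin L, Fin (n ((l : ℕ) + 1)) => ‖WeightNorm.row θ p.1 p.2‖)
  have hw : 0 < WeightNorm.minRowNorm θ := (norm_pos_iff.2 (hrow p.1 p.2)).trans_eq hp
  have hle : ∀ (l : Fin L) (i : Fin (n ((l : ℕ) + 1))),
      WeightNorm.minRowNorm θ ≤ ‖WeightNorm.row θ l i‖ := fun l i =>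
    ciInf_le (f := fun p : Σ l : Fin L, Fin (n ((l : ℕ) + 1)) => ‖WeightNorm.row θ p.1 p.2‖)
      (Set.finite_range _).bddBelow ⟨l, i⟩
  obtain ⟨b₀, b₁, hjet⟩ :=
    WeightNorm.jetBound_predictor hφ hφ' h₁ h₂ hm hL hn hx hw hle hρ hv
  rw [abs_of_nonneg hβ]
  exact hjet.gradient
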